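/- Let $(X,A,Y)\sim P$ take values in $\mathcal X\times\mathcal A\times\{0,1\}$ and let $\mathcal H$ be a class of measurable classifiers $h:\mathcal X\to\{0,1\}$. Put $\mathrm{acc}(h)=P(h(X)=Y)$ and let $$\Phi_{\mathrm{fair}}(h)=\Bigl|\sum_{j=1}^m \mathbb E\bigl[g_j(X,A,Y,h(X))\mid \mathcal E_j\bigr]\Bigr|,$$ where the $g_j$ are measurable with $|g_j|\le B$ and the $\mathcal E_j$ are events determined by $(X,A,Y)$ with $P(\mathcal E_j)\ge p>0$; assume $\Phi_{\mathrm{fair}}(h)\in[0,1]$ for all $h\in\mathcal H$. For $\psi\in[0,1]$ let $\tau^*_{\mathrm{fair}}(\psi)=\inf\{\Phi_{\mathrm{fair}}(h): h\in\mathcal H,\ \mathrm{acc}(h)\ge\psi\}$, with $\tau^*_{\mathrm{fair}}(\psi)=1$ if no $h\in\mathcal H$ has $\mathrm{acc}(h)\ge\psi$, and let $\Delta(h)=\Phi_{\mathrm{fair}}(h)-\tau^*_{\mathrm{fair}}(\mathrm{acc}(h))$. Let $\mathcal D_{\mathrm{tr}}$ consist of $n\ge1$ i.i.d. draws from $P$.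 Let $\widehat{\mathrm{acc}}(h)$ be the fraction of $\mathcal D_{\mathrm{tr}}$ that $h$ classifies correctly, and let $\widehat{\Phi_{\mathrm{fair}}}(h)$ be obtained from $\Phi_{\mathrm{fair}}(h)$ by replacing each conditional expectation by the average over the points of $\mathcal D_{\mathrm{tr}}$ lying in $\mathcal E_j$ (an empty average is $0$). Let $$\mathcal R_n(\mathcal H)=\mathbb E\Bigl[\sup_{h\in\mathcal H}\tfrac1n\sum_{i=1}^n\sigma_i h(X_i)\Bigr]$$ be the Rademacher complexity of $\mathcal H$, with $X_i$ i.i.d. copies of $X$ and $\sigma_i$ independent uniform signs (the expectation is an outer expectation if the supremum is not measurable). Assume that $\tau^*_{\mathrm{fair}}$ is $L$-Lipschitz on $[0,1]$ and that $\mathcal R_n(\mathcal H)\le C\,n^{-\gamma}$ with $C\ge0$ and $\gamma\le 1/2$. Then for all $\delta\in\mathbb R$ and $\eta\in(0,1)$, with probability at least $1-\eta$ over $\mathcal D_{\mathrm{tr}}$, every $h\in\mathcal H$ that minimises $\widehat{\Phi_{\mathrm{fair}}}$ over $\{h'\in\mathcal H:\widehat{\mathrm{acc}}(h')\ge\delta\}$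 satisfies $$\Delta(h)\le K\,\bigl(1+\log(1/\eta)\bigr)^{k}\,n^{-\gamma},$$ where the constants $K$ and $k\in\mathbb N$ depend only on $L,C,\gamma,B,p,m$. -/

import Mathlib

open MeasureTheory

noncomputable section

namespace FairTradeoff

/-- The numerical value in `{0, 1}` of a binary label. -/
def val (b : Bool) : ℝ := if b then 1 else 0

/-- Upper (outer) expectation `E*[f]`, the infimum of `E[g]` over integrable `g ≥ f`.
It is the usual expectation when `f` is integrable (`upperExpectation_eq_integral`), and it makes
sense for suprema over uncountable classes, which need not be measurable. -/
def upperExpectation {Ω : Type*} [MeasurableSpace Ω] (μ : Measure Ω) (f : Ω → ℝ) : ℝ :=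
  sInf {r : ℝ | ∃ g : Ω → ℝ, Integrable g μ ∧ (∀ ω, f ω ≤ g ω) ∧ ∫ ω, g ω ∂μ = r}

theorem upperExpectation_eq_integral {Ω : Type*} [MeasurableSpace Ω] (μ : Measure Ω) (f : Ω → ℝ)
    (hf : Integrable f μ) : upperExpectation μ f = ∫ ω, f ω ∂μ := by
  refine IsLeast.csInf_eq ⟨⟨f, hf, fun _ => le_rfl, rfl⟩, ?_⟩
  rintro r ⟨g, hg, hfg, rfl⟩
  exact integral_mono hf hg hfg

/-- Rademacher complexity `R_n(H) = E_σ E_x [ sup_{h ∈ H} (1/n) ∑ i, σ i * h (x i) ]` of a class of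
binary classifiers, with `σ` uniform on `{-1, 1}^n` and `x` an i.i.d. sample of size `n` from `μ`. -/
def rademacherComplexity {X : Type*} [MeasurableSpace X] (μ : Measure X) (H : Set (X → Bool))
    (n : ℕ) : ℝ :=
  (1 / (2 : ℝ) ^ n) * ∑ σ : Fin n → ℤˣ,
    upperExpectation (Measure.pi fun _ : Fin n => μ)
      (fun x => ⨆ h : H, (1 / (n : ℝ)) * ∑ i, ((σ i : ℤ) : ℝ) * val (h.1 (x i)))

/-- The data of a fairness violation
`Φ(h) = |∑ j, E[g_j(X, A, Y, h(X)) | E_j]|` with `m` terms; a data point is a triple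
`(X, A, Y)` with a binary label `Y`. -/
structure FairnessMetric (X A : Type*) [MeasurableSpace X] [MeasurableSpace A] (m : ℕ) where
  /-- The functions `g_j(x, a, y, h(x))`; the last argument is the prediction. -/
  g : Fin m → X × A × Bool → Bool → ℝ
  /-- The conditioning events, determined by `(X, A, Y)`. -/
  event : Fin m → Set (X × A × Bool)
  measurable_g : ∀ j b, Measurable fun z => g j z b
  measurableSet_event : ∀ j, MeasurableSet (event j)

variable {X A : Type*} [MeasurableSpace X] [MeasurableSpace A] {m : ℕ}

/-- Accuracy `P(h(X) = Y)`. -/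
def acc (P : Measure (X × A × Bool)) (h : X → Bool) : ℝ :=
  P.real {z | h z.1 = z.2.2}

/-- Fairness violation over the data distribution. -/
def fair (P : Measure (X × A × Bool)) (F : FairnessMetric X A m) (h : X → Bool) : ℝ :=
  |∑ j, ∫ z, F.g j z (h z.1) ∂(ProbabilityTheory.cond P (F.event j))|

/-- Empirical accuracy: the fraction of the sample that is classified correctly. -/
def empAcc {n : ℕ} (D : Fin n → X × A × Bool) (h : X → Bool) : ℝ :=
  (∑ i, if h (D i).1 = (D i).2.2 then (1 : ℝ) else 0) / n

open Classical in
/-- Empirical fairness violation: each conditional expectation is replaced by the average over the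
sample points that lie in the event (an average over no points is `0`). -/
def empFair {n : ℕ} (F : FairnessMetric X A m) (D : Fin n → X × A × Bool) (h : X → Bool) : ℝ :=
  |∑ j, (∑ i, if D i ∈ F.event j then F.g j (D i) (h (D i).1) else 0) /
    (∑ i, if D i ∈ F.event j then (1 : ℝ) else 0)|

open Classical in
/-- The optimal accuracy-fairness trade-off curve: the least fairness violation among classifiers
in `H` of accuracy at least `ψ`, and `1` if the accuracy `ψ` is unattainable. -/
def tradeoff (P : Measure (X × A × Bool)) (F : FairnessMetric X A m) (H : Set (X → Bool))
    (ψ : ℝ) : ℝ :=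
  if ∃ h ∈ H, ψ ≤ acc P h then sInf (fair P F '' {h | h ∈ H ∧ ψ ≤ acc P h}) else 1

/-- The suboptimality gap `Δ(h) = Φ(h) - τ*(acc(h))`. -/
def gap (P : Measure (X × A × Bool)) (F : FairnessMetric X A m) (H : Set (X → Bool))
    (h : X → Bool) : ℝ :=
  fair P F h - tradeoff P F H (acc P h)

/-- `h` minimises the empirical fairness violation over `H` subject to empirical accuracy at
least `δ`. -/
def IsEmpiricalMinimiser {n : ℕ} (F : FairnessMetric X A m) (H : Set (X → Bool)) (δ : ℝ)
    (D : Fin n → X × A × Bool) (h : X → Bool) : Prop :=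
  (h ∈ H ∧ δ ≤ empAcc D h) ∧ ∀ h' ∈ H, δ ≤ empAcc D h' → empFair F D h ≤ empFair F D h'

end FairTradeoff

end

namespace FairTradeoff

/-
A classifier enters the accuracy and the fairness violation only through means of functions of the
data point and the binary prediction. Symmetrisation and contraction bound the upper expectation of
the uniform deviation of such empirical means by the Rademacher complexity, and the
bounded-differences inequality concentrates the deviation there, so empirical and true values agree
uniformly up to some `ε` of order `n ^ (-γ)`. A classifier of true accuracy at least `acc h + 2ε`
is then empirically at least as accurate as the minimiser `h`, so `h` is near-optimal at that
slightly higher level, and the Lipschitz bound on `τ*` pays for the shift.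

The exception is a level capped at `1`, which leaves no room for a margin. There one needs
classifiers of accuracy `1` to be correct on the whole sample; each of them almost surely is, and
countably many of them suffice to approximate the fairness infimum.
-/

open ProbabilityTheory
open scoped NNReal

theorem integrable_of_measurable_of_abs_le {Ω : Type*} [MeasurableSpace Ω] {μ : Measure Ω}
    [IsFiniteMeasure μ] {f : Ω → ℝ} {b : ℝ} (hf : Measurable f) (hb : ∀ ω, |f ω| ≤ b) :
    Integrable f μ :=
  .of_bound hf.aestronglyMeasurable b (.of_forall hb)

theorem abs_integral_le_of_abs_le {Ω : Type*} [MeasurableSpace Ω] {μ : Measure Ω}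
    [IsProbabilityMeasure μ] {f : Ω → ℝ} {b : ℝ} (hb : ∀ ω, |f ω| ≤ b) : |∫ ω, f ω ∂μ| ≤ b := by
  simpa using norm_integral_le_of_norm_le_const (μ := μ) (f := f) (.of_forall hb)

section BoundedDifferences

variable {Ω Ω' : Type*} [MeasurableSpace Ω] [MeasurableSpace Ω'] {μ : Measure Ω} {ν : Measure Ω'}

theorem hasSubgaussianMGF_sub_integral [IsProbabilityMeasure μ] {f : Ω → ℝ} {b : ℝ} {c : ℝ≥0}
    (hf : Measurable f) (hb : ∀ ω, |f ω| ≤ b) (hd : ∀ᵐ x ∂μ, ∀ᵐ y ∂μ, f x ≤ f y + c) :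
    HasSubgaussianMGF (fun ω => f ω - ∫ y, f y ∂μ) ((c / 2) ^ 2) μ := by
  have hlower : ∀ ω, -b ≤ f ω := fun ω => (abs_le.1 (hb ω)).1
  have hupper : ∀ ω, f ω ≤ b := fun ω => (abs_le.1 (hb ω)).2
  have hbdd : Filter.IsBoundedUnder (· ≥ ·) (ae μ) f := Filter.isBoundedUnder_of ⟨-b, hlower⟩
  have hcobdd : Filter.IsCoboundedUnder (· ≥ ·) (ae μ) f :=
    (Filter.isBoundedUnder_of (r := (· ≤ ·)) ⟨b, hupper⟩).isCoboundedUnder_ge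
  have hI : ∀ᵐ x ∂μ, f x ∈ Set.Icc (essInf f μ) (essInf f μ + c) := by
    filter_upwards [ae_essInf_le hbdd, hd] with x hx hxy
    refine ⟨hx, sub_le_iff_le_add.1 (le_essInf_of_ae_le _ ?_ hcobdd)⟩
    filter_upwards [hxy] with y hy using sub_le_iff_le_add.2 hy
  simpa using hasSubgaussianMGF_of_mem_Icc hf.aemeasurable hI

theorem hasSubgaussianMGF_prod [SFinite μ] [SFinite ν] {f : Ω × Ω' → ℝ} {g : Ω → ℝ} {c₁ c₂ : ℝ≥0}
    (hf : ∀ t, Integrable (fun q => Real.exp (t * f q)) (μ.prod ν))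
    (hg : HasSubgaussianMGF g c₁ μ)
    (hfg : ∀ᵐ x ∂μ, HasSubgaussianMGF (fun y => f (x, y) - g x) c₂ ν) :
    HasSubgaussianMGF f (c₁ + c₂) (μ.prod ν) where
  integrable_exp_mul := hf
  mgf_le t := by
    have hsplit : ∀ x, ∫ y, Real.exp (t * f (x, y)) ∂ν =
        Real.exp (t * g x) * mgf (fun y => f (x, y) - g x) ν t := fun x => by
      rw [mgf, ← integral_const_mul]
      congr with y
      rw [← Real.exp_add]
      ring_nf
    calc mgf f (μ.prod ν) t
      _ = ∫ x, Real.exp (t * g x) * mgf (fun y => f (x, y) - g x) ν t ∂μ := by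
        rw [mgf, integral_prod _ (hf t)]
        exact integral_congr_ae (.of_forall hsplit)
      _ ≤ ∫ x, Real.exp (t * g x) * Real.exp (c₂ * t ^ 2 / 2) ∂μ := by
        refine integral_mono_of_nonneg
          (.of_forall fun x => mul_nonneg (Real.exp_pos _).le mgf_nonneg)
          ((hg.integrable_exp_mul t).mul_const _) ?_
        filter_upwards [hfg] with x hx
        gcongr
        exact hx.mgf_le t
      _ = mgf g μ t * Real.exp (c₂ * t ^ 2 / 2) := integral_mul_const _ _
      _ ≤ Real.exp (c₁ * t ^ 2 / 2) * Real.exp (c₂ * t ^ 2 / 2) := by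
        gcongr
        exact hg.mgf_le t
      _ = Real.exp ((c₁ + c₂ : ℝ≥0) * t ^ 2 / 2) := by
        rw [← Real.exp_add]
        push_cast
        ring_nf

theorem hasSubgaussianMGF_of_comp {φ : Ω → Ω'} {f : Ω' → ℝ} {c : ℝ≥0}
    (hφ : MeasurePreserving φ μ ν) (hf : Measurable f) (h : HasSubgaussianMGF (f ∘ φ) c μ) :
    HasSubgaussianMGF f c ν := by
  rw [← HasSubgaussianMGF.id_map_iff hf.aemeasurable, ← hφ.map_eq,
    Measure.map_map hf hφ.measurable]
  exact (HasSubgaussianMGF.id_map_iff (hf.comp hφ.measurable).aemeasurable).2 h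

theorem measurePreserving_cons {n : ℕ} {Z : Fin (n + 1) → Type*} [∀ i, MeasurableSpace (Z i)]
    (μ : ∀ i, Measure (Z i)) [∀ i, SigmaFinite (μ i)] :
    MeasurePreserving (fun q : Z 0 × (∀ i : Fin n, Z i.succ) => (Fin.cons q.1 q.2 : ∀ i, Z i))
      ((μ 0).prod (Measure.pi fun i : Fin n => μ i.succ)) (Measure.pi μ) := by
  have hcons : (fun q : Z 0 × (∀ i : Fin n, Z i.succ) => (Fin.cons q.1 q.2 : ∀ i, Z i)) =
      (MeasurableEquiv.piFinSuccAbove Z 0).symm :=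
    funext fun q => (Fin.insertNth_zero q.1 q.2).symm
  rw [hcons]
  exact (measurePreserving_piFinSuccAbove μ 0).symm

theorem integral_le_integral_add_of_ae_le [IsProbabilityMeasure μ] [IsProbabilityMeasure ν]
    {f : Ω × Ω' → ℝ} {b c : ℝ} (hf : Measurable f) (hb : ∀ q, |f q| ≤ b)
    (hd : ∀ᵐ q ∂μ.prod ν, ∀ᵐ w ∂μ, f q ≤ f (w, q.2) + c) :
    ∀ᵐ x ∂μ, ∀ᵐ w ∂μ, ∫ y, f (x, y) ∂ν ≤ ∫ y, f (w, y) ∂ν + c := by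
  have hint : ∀ x, Integrable (fun y => f (x, y)) ν := fun x =>
    integrable_of_measurable_of_abs_le (by fun_prop) fun _ => hb _
  filter_upwards [Measure.ae_ae_of_ae_prod hd] with x hx
  have hmeas : MeasurableSet {q : Ω' × Ω | f (x, q.1) ≤ f (q.2, q.1) + c} :=
    measurableSet_le (by fun_prop) (by fun_prop)
  filter_upwards [(Measure.ae_ae_comm hmeas).1 hx] with w hw
  calc ∫ y, f (x, y) ∂ν
    _ ≤ ∫ y, (f (w, y) + c) ∂ν := integral_mono_ae (hint x) ((hint w).add (integrable_const c)) hw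
    _ = ∫ y, f (w, y) ∂ν + c := by simp [integral_add (hint w) (integrable_const c)]

theorem hasSubgaussianMGF_prod_of_ae_le [IsProbabilityMeasure μ] [IsProbabilityMeasure ν]
    {f : Ω × Ω' → ℝ} {b : ℝ} {c c' : ℝ≥0} (hf : Measurable f) (hb : ∀ q, |f q| ≤ b)
    (hd : ∀ᵐ q ∂μ.prod ν, ∀ᵐ w ∂μ, f q ≤ f (w, q.2) + c)
    (hsub : ∀ᵐ x ∂μ, HasSubgaussianMGF (fun y => f (x, y) - ∫ y, f (x, y) ∂ν) c' ν) :
    HasSubgaussianMGF (fun q => f q - ∫ q, f q ∂μ.prod ν) ((c / 2) ^ 2 + c') (μ.prod ν) := by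
  have hf' : ∀ q, f q - ∫ q, f q ∂μ.prod ν ∈ Set.Icc (-b - ∫ q, f q ∂μ.prod ν)
      (b - ∫ q, f q ∂μ.prod ν) := fun q =>
    ⟨sub_le_sub_right (abs_le.1 (hb q)).1 _, sub_le_sub_right (abs_le.1 (hb q)).2 _⟩
  have hmean : ∫ q, f q ∂μ.prod ν = ∫ x, ∫ y, f (x, y) ∂ν ∂μ :=
    integral_prod _ (integrable_of_measurable_of_abs_le hf hb)
  refine hasSubgaussianMGF_prod
    (fun t => integrable_exp_mul_of_mem_Icc (hf.sub_const _).aemeasurable (.of_forall hf'))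
    (g := fun x => ∫ y, f (x, y) ∂ν - ∫ q, f q ∂μ.prod ν) ?_ (by simpa using hsub)
  rw [hmean]
  exact hasSubgaussianMGF_sub_integral hf.stronglyMeasurable.integral_prod_right'.measurable
    (fun x => abs_integral_le_of_abs_le fun y => hb (x, y))
    (integral_le_integral_add_of_ae_le hf hb hd)

theorem hasSubgaussianMGF_of_bounded_differences {n : ℕ} {Z : Fin n → Type*}
    [∀ i, MeasurableSpace (Z i)] {μ : ∀ i, Measure (Z i)} [∀ i, IsProbabilityMeasure (μ i)]
    {f : (∀ i, Z i) → ℝ} {b : ℝ} {c : Fin n → ℝ≥0} (hf : Measurable f) (hb : ∀ z, |f z| ≤ b)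
    (hd : ∀ i, ∀ᵐ z ∂Measure.pi μ, ∀ᵐ w ∂μ i, f z ≤ f (Function.update z i w) + c i) :
    HasSubgaussianMGF (fun z => f z - ∫ y, f y ∂Measure.pi μ) (∑ i, (c i / 2) ^ 2)
      (Measure.pi μ) := by
  induction n with
  | zero =>
    have hconst : ∀ z, f z - ∫ y, f y ∂Measure.pi μ = 0 := fun z => by
      simp [Subsingleton.elim _ z]
    simp [hconst]
  | succ n ih =>
    have hcons := measurePreserving_cons μ
    have hf' : Measurable fun q : Z 0 × (∀ i : Fin n, Z i.succ) => f (Fin.cons q.1 q.2) :=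
      hf.comp hcons.measurable
    have hd' := fun i => hcons.quasiMeasurePreserving.ae (hd i)
    have hfirst : ∀ᵐ q ∂(μ 0).prod (Measure.pi fun i : Fin n => μ i.succ), ∀ᵐ w ∂μ 0,
        f (Fin.cons q.1 q.2) ≤ f (Fin.cons w q.2) + c 0 := by
      simpa only [Fin.update_cons_zero] using hd' 0
    have hrest : ∀ᵐ x ∂μ 0, HasSubgaussianMGF
        (fun z => f (Fin.cons x z) - ∫ y, f (Fin.cons x y) ∂Measure.pi fun i : Fin n => μ i.succ)
        (∑ i : Fin n, (c i.succ / 2) ^ 2) (Measure.pi fun i : Fin n => μ i.succ) := by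
      filter_upwards [ae_all_iff.2 fun i : Fin n => Measure.ae_ae_of_ae_prod (hd' i.succ)]
        with x hx
      refine ih (hf'.comp measurable_prodMk_left) (fun _ => hb _) fun i => ?_
      simpa only [← Fin.cons_update] using hx i
    have hsub := hasSubgaussianMGF_prod_of_ae_le hf' (fun _ => hb _) hfirst hrest
    rw [Fin.sum_univ_succ]
    refine hasSubgaussianMGF_of_comp hcons (by fun_prop) ?_
    rwa [← hcons.map_eq, integral_map hcons.measurable.aemeasurable hf.aestronglyMeasurable]

end BoundedDifferences

section UpperExpectation

variable {Ω Ω' : Type*} [MeasurableSpace Ω] [MeasurableSpace Ω'] {μ : Measure Ω} {ν : Measure Ω'}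

theorem integral_le_integral_of_lintegral_ofReal_le {u v : Ω → ℝ} (hu : Integrable u μ)
    (hv : Integrable v μ) (hv0 : 0 ≤ v)
    (h : ∫⁻ ω, ENNReal.ofReal (u ω) ∂μ ≤ ∫⁻ ω, ENNReal.ofReal (v ω) ∂μ) :
    ∫ ω, u ω ∂μ ≤ ∫ ω, v ω ∂μ := by
  rw [integral_eq_lintegral_pos_part_sub_lintegral_neg_part hu,
    integral_eq_lintegral_of_nonneg_ae (.of_forall hv0) hv.aestronglyMeasurable]
  exact (sub_le_self _ ENNReal.toReal_nonneg).trans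
    (ENNReal.toReal_mono hv.lintegral_lt_top.ne h)

/-- `g` is a measurable cover of `f`: a measurable majorant whose integral is the upper
expectation of `f`. Covers reduce statements about suprema over uncountable classes to measurable
functions. -/
structure IsMeasurableCover (μ : Measure Ω) (f g : Ω → ℝ) : Prop where
  measurable : Measurable g
  le (ω : Ω) : f ω ≤ g ω
  integral_eq : ∫ ω, g ω ∂μ = upperExpectation μ f

theorem exists_isMeasurableCover [IsProbabilityMeasure μ] {f : Ω → ℝ} {b : ℝ}
    (hf : ∀ ω, |f ω| ≤ b) : ∃ g, IsMeasurableCover μ f g ∧ ∀ ω, |g ω| ≤ b := by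
  obtain ⟨ψ, hψm, hψle, hψeq⟩ :=
    exists_measurable_le_lintegral_eq μ fun ω => ENNReal.ofReal (b - f ω)
  have hψ0 : ∀ ω, 0 ≤ (ψ ω).toReal := fun _ => ENNReal.toReal_nonneg
  have hψf : ∀ ω, (ψ ω).toReal ≤ b - f ω := fun ω =>
    ENNReal.toReal_le_of_le_ofReal (by linarith [le_of_abs_le (hf ω)]) (hψle ω)
  have hψfin : ∀ ω, ENNReal.ofReal (ψ ω).toReal = ψ ω := fun ω =>
    ENNReal.ofReal_toReal ((hψle ω).trans_lt ENNReal.ofReal_lt_top).ne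
  have hcover : ∀ ω, f ω ≤ b - (ψ ω).toReal := fun ω => le_sub_comm.1 (hψf ω)
  have hbound : ∀ ω, |b - (ψ ω).toReal| ≤ b := fun ω =>
    abs_le.2 ⟨(neg_le_of_abs_le (hf ω)).trans (hcover ω), sub_le_self _ (hψ0 ω)⟩
  have hmeas : Measurable fun ω => b - (ψ ω).toReal := by fun_prop
  have hint : Integrable (fun ω => b - (ψ ω).toReal) μ :=
    integrable_of_measurable_of_abs_le hmeas hbound
  have hψint : Integrable (fun ω => (ψ ω).toReal) μ :=
    ((integrable_const b).sub hint).congr (.of_forall fun ω => sub_sub_cancel b _)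
  refine ⟨fun ω => b - (ψ ω).toReal, ⟨hmeas, hcover, ?_⟩, hbound⟩
  symm
  refine IsLeast.csInf_eq ⟨⟨_, hint, hcover, rfl⟩, ?_⟩
  rintro _ ⟨g, hg, hfg, rfl⟩
  have hle : ∫ ω, (b - g ω) ∂μ ≤ ∫ ω, (ψ ω).toReal ∂μ := by
    refine integral_le_integral_of_lintegral_ofReal_le ((integrable_const b).sub hg) hψint hψ0 ?_
    simp only [hψfin, ← hψeq]
    exact lintegral_mono fun ω => ENNReal.ofReal_le_ofReal (sub_le_sub_left (hfg ω) b)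
  rw [integral_sub (integrable_const b) hg] at hle
  rw [integral_sub (integrable_const b) hψint]
  linarith

theorem upperExpectation_le_integral {f g l : Ω → ℝ} (hl : Integrable l μ) (hlf : ∀ ω, l ω ≤ f ω)
    (hg : Integrable g μ) (hfg : ∀ ω, f ω ≤ g ω) : upperExpectation μ f ≤ ∫ ω, g ω ∂μ := by
  refine csInf_le ⟨∫ ω, l ω ∂μ, ?_⟩ ⟨g, hg, hfg, rfl⟩
  rintro _ ⟨g', hg', hfg', rfl⟩
  exact integral_mono hl hg' fun ω => (hlf ω).trans (hfg' ω)

theorem IsMeasurableCover.ae_le {f g l g' : Ω → ℝ} (hg : IsMeasurableCover μ f g)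
    (hl : Integrable l μ) (hlf : ∀ ω, l ω ≤ f ω) (hgi : Integrable g μ) (hg' : Measurable g')
    (hfg' : ∀ ω, f ω ≤ g' ω) : g ≤ᵐ[μ] g' := by
  have hmin : Integrable (fun ω => min (g ω) (g' ω)) μ :=
    integrable_of_le_of_le (hg.measurable.min hg').aestronglyMeasurable
      (.of_forall fun ω => (hlf ω).trans (le_min (hg.le ω) (hfg' ω)))
      (.of_forall fun ω => min_le_left _ _) hl hgi
  have hle : (fun ω => min (g ω) (g' ω)) ≤ᵐ[μ] g := .of_forall fun ω => min_le_left _ _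
  have heq : ∫ ω, min (g ω) (g' ω) ∂μ = ∫ ω, g ω ∂μ := by
    refine le_antisymm (integral_mono_ae hmin hgi hle) ?_
    rw [hg.integral_eq]
    exact upperExpectation_le_integral hl hlf hmin fun ω => le_min (hg.le ω) (hfg' ω)
  filter_upwards [(integral_eq_iff_of_ae_le hmin hgi hle).1 heq] with ω hω
  exact hω ▸ min_le_right _ _

theorem IsMeasurableCover.integral_comp {φ : Ω → Ω'} {f g : Ω' → ℝ}
    (hg : IsMeasurableCover ν f g) (hφ : MeasurePreserving φ μ ν) :
    ∫ ω, g (φ ω) ∂μ = upperExpectation ν f := by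
  rw [← integral_map hφ.measurable.aemeasurable hg.measurable.aestronglyMeasurable, hφ.map_eq,
    hg.integral_eq]

theorem upperExpectation_comp_le [IsProbabilityMeasure μ] [IsProbabilityMeasure ν] {φ : Ω → Ω'}
    (hφ : MeasurePreserving φ μ ν) {f : Ω' → ℝ} {b : ℝ} (hf : ∀ ω, |f ω| ≤ b) :
    upperExpectation μ (fun ω => f (φ ω)) ≤ upperExpectation ν f := by
  obtain ⟨g, hg, hgb⟩ := exists_isMeasurableCover (μ := ν) hf
  rw [← hg.integral_comp hφ]
  exact upperExpectation_le_integral (integrable_const (-b)) (fun ω => neg_le_of_abs_le (hf _))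
    (integrable_of_measurable_of_abs_le (hg.measurable.comp hφ.measurable) fun ω => hgb _)
    fun ω => hg.le _

theorem upperExpectation_const_mul_le [IsProbabilityMeasure μ] {f : Ω → ℝ} {b c : ℝ}
    (hf : ∀ ω, |f ω| ≤ b) (hc : 0 ≤ c) :
    upperExpectation μ (fun ω => c * f ω) ≤ c * upperExpectation μ f := by
  obtain ⟨g, hg, hgb⟩ := exists_isMeasurableCover (μ := μ) hf
  rw [← hg.integral_eq, ← integral_const_mul]
  exact upperExpectation_le_integral (integrable_const (c * -b))
    (fun ω => mul_le_mul_of_nonneg_left (neg_le_of_abs_le (hf ω)) hc)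
    ((integrable_of_measurable_of_abs_le hg.measurable hgb).const_mul c)
    fun ω => mul_le_mul_of_nonneg_left (hg.le ω) hc

theorem upperExpectation_add_le [IsProbabilityMeasure μ] {a f : Ω → ℝ} {b : ℝ}
    (ha : Integrable a μ) (hf : ∀ ω, |f ω| ≤ b) :
    upperExpectation μ (fun ω => a ω + f ω) ≤ ∫ ω, a ω ∂μ + upperExpectation μ f := by
  obtain ⟨g, hg, hgb⟩ := exists_isMeasurableCover (μ := μ) hf
  have hgi : Integrable g μ := integrable_of_measurable_of_abs_le hg.measurable hgb
  rw [← hg.integral_eq, ← integral_add ha hgi]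
  exact upperExpectation_le_integral (ha.add (integrable_const (-b)))
    (fun ω => add_le_add_right (neg_le_of_abs_le (hf ω)) _) (ha.add hgi)
    fun ω => add_le_add_right (hg.le ω) _

end UpperExpectation

section HoldsWithProb

variable {Ω : Type*} [MeasurableSpace Ω] {μ : Measure Ω} {Q R : Ω → Prop} {η : ℝ}

/-- `Q` holds with probability at least `1 - η`, in the sense of inner measure: `Q` itself need not
be measurable, but it holds throughout a measurable event of that probability. -/
def HoldsWithProb (μ : Measure Ω) (η : ℝ) (Q : Ω → Prop) : Prop :=
  ∃ G, MeasurableSet G ∧ 1 - η ≤ μ.real G ∧ ∀ ω ∈ G, Q ω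

theorem HoldsWithProb.mono (hQ : HoldsWithProb μ η Q) (h : ∀ ω, Q ω → R ω) :
    HoldsWithProb μ η R :=
  let ⟨G, hGm, hGη, hG⟩ := hQ
  ⟨G, hGm, hGη, fun ω hω => h ω (hG ω hω)⟩

theorem HoldsWithProb.and_ae (hQ : HoldsWithProb μ η Q) (hR : ∀ᵐ ω ∂μ, R ω) :
    HoldsWithProb μ η fun ω => Q ω ∧ R ω := by
  obtain ⟨G, hGm, hGη, hG⟩ := hQ
  obtain ⟨S, hRS, hSm, hS⟩ := exists_measurable_superset_of_null (ae_iff.1 hR)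
  refine ⟨G \ S, hGm.diff hSm, ?_, fun ω hω => ⟨hG ω hω.1, not_not.1 fun h => hω.2 (hRS h)⟩⟩
  rwa [measureReal_def, measure_sdiff_null hS, ← measureReal_def]

theorem HoldsWithProb.forall [IsProbabilityMeasure μ] {κ : Type*} [Fintype κ] {η : κ → ℝ}
    {Q : κ → Ω → Prop} (hQ : ∀ k, HoldsWithProb μ (η k) (Q k)) :
    HoldsWithProb μ (∑ k, η k) fun ω => ∀ k, Q k ω := by
  choose G hGm hGη hG using hQ
  refine ⟨⋂ k, G k, .iInter hGm, ?_, fun ω hω k => hG k ω (Set.mem_iInter.1 hω k)⟩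
  have hcompl : ∀ k, μ.real (G k)ᶜ ≤ η k := fun k => by
    rw [probReal_compl_eq_one_sub (hGm k)]
    linarith [hGη k]
  have hunion : μ.real (⋂ k, G k)ᶜ ≤ ∑ k, η k := by
    rw [Set.compl_iInter]
    exact (measureReal_iUnion_fintype_le _).trans (Finset.sum_le_sum fun k _ => hcompl k)
  rw [probReal_compl_eq_one_sub (.iInter hGm)] at hunion
  linarith

theorem holdsWithProb_le_upperExpectation_add {n : ℕ} {Z : Fin n → Type*}
    [∀ i, MeasurableSpace (Z i)] {μ : ∀ i, Measure (Z i)} [∀ i, IsProbabilityMeasure (μ i)]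
    {f : (∀ i, Z i) → ℝ} {b s : ℝ} {c : Fin n → ℝ≥0} (hb : ∀ z, |f z| ≤ b) (hs : 0 ≤ s)
    (hd : ∀ i z w, f z ≤ f (Function.update z i w) + c i) :
    HoldsWithProb (Measure.pi μ) (Real.exp (-s ^ 2 / (2 * ∑ i, (c i / 2 : ℝ) ^ 2)))
      fun z => f z ≤ upperExpectation (Measure.pi μ) f + s := by
  obtain ⟨g, hg, hgb⟩ := exists_isMeasurableCover (μ := Measure.pi μ) hb
  have hgi := integrable_of_measurable_of_abs_le (μ := Measure.pi μ) hg.measurable hgb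
  have hgd : ∀ i, ∀ᵐ z ∂Measure.pi μ, ∀ᵐ w ∂μ i, g z ≤ g (Function.update z i w) + c i := by
    intro i
    have hupdate : Measurable fun q : (∀ i, Z i) × Z i => g (Function.update q.1 i q.2) :=
      hg.measurable.comp measurable_update'
    have hset : MeasurableSet
        {q : (∀ i, Z i) × Z i | g q.1 ≤ g (Function.update q.1 i q.2) + c i} :=
      measurableSet_le (hg.measurable.comp measurable_fst) (hupdate.add_const _)
    refine (Measure.ae_ae_comm hset).2 (.of_forall fun w => ?_)
    exact hg.ae_le (integrable_const (-b)) (fun z => neg_le_of_abs_le (hb z)) hgi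
      ((hg.measurable.comp measurable_update_left).add_const _)
      fun z => (hd i z w).trans (add_le_add_left (hg.le _) _)
  have htail := (hasSubgaussianMGF_of_bounded_differences hg.measurable hgb hgd).measure_ge_le hs
  have hmeas : MeasurableSet {z | s ≤ g z - ∫ y, g y ∂Measure.pi μ} :=
    measurableSet_le measurable_const (hg.measurable.sub_const _)
  refine ⟨_, hmeas.compl, ?_, fun z hz => ?_⟩
  · rw [probReal_compl_eq_one_sub hmeas]
    push_cast at htail
    linarith
  · have hlt : g z - ∫ y, g y ∂Measure.pi μ < s := not_le.1 hz
    rw [← hg.integral_eq]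
    linarith [hg.le z]

end HoldsWithProb

section RademacherSum

variable {ι Z : Type*} {n : ℕ} {b : ℝ}

theorem bddAbove_range_of_abs_le {f : ι → ℝ} (hf : ∀ k, |f k| ≤ b) : BddAbove (Set.range f) :=
  ⟨b, Set.forall_mem_range.2 fun k => le_of_abs_le (hf k)⟩

theorem abs_ciSup_le_of_abs_le [Nonempty ι] {f : ι → ℝ} (hf : ∀ k, |f k| ≤ b) : |⨆ k, f k| ≤ b :=
  let ⟨k⟩ := ‹Nonempty ι›
  abs_le.2 ⟨(neg_le_of_abs_le (hf k)).trans (le_ciSup (bddAbove_range_of_abs_le hf) k),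
    ciSup_le fun k => le_of_abs_le (hf k)⟩

theorem abs_sum_fin_le {f : Fin n → ℝ} (hf : ∀ i, |f i| ≤ b) : |∑ i, f i| ≤ n * b := by
  simpa using (Finset.abs_sum_le_sum_abs f .univ).trans
    (Finset.sum_le_card_nsmul _ _ b fun i _ => hf i)

theorem abs_unit_mul (s : ℤˣ) (x : ℝ) : |((s : ℤ) : ℝ) * x| = |x| := by
  rcases Int.units_eq_one_or s with rfl | rfl <;> simp

theorem sum_intUnits (f : ℤˣ → ℝ) : ∑ s, f s = f 1 + f (-1) := by
  rw [UnitsInt.univ, Finset.sum_pair (by decide)]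

theorem card_signs : Fintype.card (Fin n → ℤˣ) = 2 ^ n := by simp

/-- The supremum `sup_k ∑ i, σ i * v k (z i)` over a family `v` of functions, for fixed signs `σ`
and a fixed sample `z`. -/
noncomputable def signedSup (v : ι → Z → ℝ) (σ : Fin n → ℤˣ) (z : Fin n → Z) : ℝ :=
  ⨆ k, ∑ i, ((σ i : ℤ) : ℝ) * v k (z i)

/-- The unnormalised Rademacher complexity `E_σ E*_z [sup_k ∑ i, σ i * v k (z i)]` of a family `v`
of real functions, for a sample `z` with law `Q`. -/
noncomputable def rademacherSum [MeasurableSpace Z] (Q : Measure (Fin n → Z)) (v : ι → Z → ℝ) : ℝ :=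
  1 / (2 : ℝ) ^ n * ∑ σ, upperExpectation Q (signedSup v σ)

theorem abs_signed_sum_le {v : Z → ℝ} (hv : ∀ z, |v z| ≤ b) (σ : Fin n → ℤˣ) (z : Fin n → Z) :
    |∑ i, ((σ i : ℤ) : ℝ) * v (z i)| ≤ n * b :=
  abs_sum_fin_le fun i => (abs_unit_mul (σ i) _).trans_le (hv (z i))

theorem le_signedSup {v : ι → Z → ℝ} (hv : ∀ k z, |v k z| ≤ b) (k : ι) (σ : Fin n → ℤˣ)
    (z : Fin n → Z) : ∑ i, ((σ i : ℤ) : ℝ) * v k (z i) ≤ signedSup v σ z :=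
  le_ciSup (bddAbove_range_of_abs_le fun k => abs_signed_sum_le (hv k) σ z) k

theorem abs_signedSup_le [Nonempty ι] {v : ι → Z → ℝ} (hv : ∀ k z, |v k z| ≤ b)
    (σ : Fin n → ℤˣ) (z : Fin n → Z) : |signedSup v σ z| ≤ n * b :=
  abs_ciSup_le_of_abs_le fun k => abs_signed_sum_le (hv k) σ z

theorem sum_sign_eq_zero (i : Fin n) : ∑ σ : Fin n → ℤˣ, ((σ i : ℤ) : ℝ) = 0 := by
  have hflip := Fintype.sum_equiv (Equiv.neg (Fin n → ℤˣ)) (fun σ => (((-σ) i : ℤ) : ℝ))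
    (fun σ => ((σ i : ℤ) : ℝ)) fun _ => rfl
  simp only [Pi.neg_apply, Units.val_neg, Int.cast_neg, Finset.sum_neg_distrib] at hflip
  linarith

/-- The probability of the sign vector `s` when the signs are independent with means `d i`.
Averaging over such signs replaces the coefficients `d i` of a sum by signs. -/
noncomputable def signWeight (d : Fin n → ℝ) (s : Fin n → ℤˣ) : ℝ :=
  ∏ i, (1 + ((s i : ℤ) : ℝ) * d i) / 2

theorem signWeight_nonneg {d : Fin n → ℝ} (hd : ∀ i, |d i| ≤ 1) (s : Fin n → ℤˣ) :
    0 ≤ signWeight d s := by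
  refine Finset.prod_nonneg fun i _ => ?_
  have hsd := neg_le_of_abs_le ((abs_unit_mul (s i) _).trans_le (hd i))
  linarith

theorem sum_signWeight (d : Fin n → ℝ) : ∑ s, signWeight d s = 1 := by
  have hprod := Fintype.prod_sum fun (i : Fin n) (s : ℤˣ) => (1 + ((s : ℤ) : ℝ) * d i) / 2
  simp only [signWeight]
  rw [← hprod]
  refine Finset.prod_eq_one fun i _ => ?_
  rw [sum_intUnits]
  push_cast
  ring

theorem sum_signWeight_mul (d : Fin n → ℝ) (k : Fin n) :
    ∑ s, signWeight d s * ((s k : ℤ) : ℝ) = d k := by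
  have hprod := Fintype.prod_sum fun (i : Fin n) (s : ℤˣ) =>
    (1 + ((s : ℤ) : ℝ) * d i) / 2 * (if i = k then ((s : ℤ) : ℝ) else 1)
  have hweight : ∀ s : Fin n → ℤˣ, signWeight d s * ((s k : ℤ) : ℝ) =
      ∏ i, ((1 + ((s i : ℤ) : ℝ) * d i) / 2 * (if i = k then ((s i : ℤ) : ℝ) else 1)) := by
    intro s
    rw [Finset.prod_mul_distrib, Finset.prod_ite_eq' Finset.univ k fun i => ((s i : ℤ) : ℝ),
      if_pos (Finset.mem_univ k), signWeight]
  rw [Finset.sum_congr rfl fun s _ => hweight s, ← hprod, Fintype.prod_eq_single k]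
  · rw [sum_intUnits, if_pos rfl, if_pos rfl]
    push_cast
    ring
  · intro i hi
    rw [sum_intUnits, if_neg hi, if_neg hi]
    push_cast
    ring

theorem sum_sum_signWeight_mul (d : Fin n → ℝ) (g : (Fin n → ℤˣ) → ℝ) :
    ∑ σ, ∑ s, signWeight d s * g (σ * s) = ∑ σ, g σ := by
  calc ∑ σ, ∑ s, signWeight d s * g (σ * s)
      = ∑ s, signWeight d s * ∑ σ, g (σ * s) := by
        rw [Finset.sum_comm]
        simp only [Finset.mul_sum]
    _ = ∑ s, signWeight d s * ∑ σ, g σ :=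
        Finset.sum_congr rfl fun s _ => congrArg (signWeight d s * ·)
          (Fintype.sum_equiv (Equiv.mulRight s) _ g fun _ => rfl)
    _ = ∑ σ, g σ := by rw [← Finset.sum_mul, sum_signWeight, one_mul]

theorem signedSup_mul_le [Nonempty ι] {d : Z → ℝ} (hd : ∀ z, |d z| ≤ 1) {u : ι → Z → ℝ}
    (hu : ∀ k z, |u k z| ≤ b) (σ : Fin n → ℤˣ) (z : Fin n → Z) :
    signedSup (fun k z => d z * u k z) σ z ≤
      ∑ s, signWeight (fun i => d (z i)) s * signedSup u (σ * s) z := by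
  refine ciSup_le fun k => ?_
  calc ∑ i, ((σ i : ℤ) : ℝ) * (d (z i) * u k (z i))
      = ∑ i, ∑ s, signWeight (fun i => d (z i)) s * ((((σ * s) i : ℤ) : ℝ) * u k (z i)) := by
        refine Finset.sum_congr rfl fun i _ => ?_
        rw [← sum_signWeight_mul (fun i => d (z i)) i, Finset.sum_mul, Finset.mul_sum]
        refine Finset.sum_congr rfl fun s _ => ?_
        rw [Pi.mul_apply, Units.val_mul, Int.cast_mul]
        ring
    _ = ∑ s, signWeight (fun i => d (z i)) s * ∑ i, (((σ * s) i : ℤ) : ℝ) * u k (z i) := by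
        rw [Finset.sum_comm]
        simp only [Finset.mul_sum]
    _ ≤ ∑ s, signWeight (fun i => d (z i)) s * signedSup u (σ * s) z :=
        Finset.sum_le_sum fun s _ => mul_le_mul_of_nonneg_left (le_signedSup hu k _ z)
          (signWeight_nonneg (fun i => hd (z i)) s)

/-- The sample that takes the `i`-th point from `q.1` if `σ i = 1` and from `q.2` otherwise. It has
the law of an i.i.d. sample for every `σ`, so it symmetrises the differences `v (q.1 i) - v (q.2 i)`
between a sample and an independent copy. -/
def mixSample (σ : Fin n → ℤˣ) (q : (Fin n → Z) × (Fin n → Z)) : Fin n → Z :=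
  fun i => if σ i = 1 then q.1 i else q.2 i

theorem mean_signed_sum_mixSample (v : Z → ℝ) (q : (Fin n → Z) × (Fin n → Z)) :
    2 * (1 / (2 : ℝ) ^ n * ∑ σ, ∑ i, ((σ i : ℤ) : ℝ) * v (mixSample σ q i)) =
      ∑ i, (v (q.1 i) - v (q.2 i)) := by
  set T := fun σ : Fin n → ℤˣ => ∑ i, ((σ i : ℤ) : ℝ) * v (mixSample σ q i) with hT
  have hpair : ∀ σ, T σ + T (-σ) = ∑ i, (v (q.1 i) - v (q.2 i)) := fun σ => by
    rw [hT, ← Finset.sum_add_distrib]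
    refine Finset.sum_congr rfl fun i _ => ?_
    simp only [mixSample, Pi.neg_apply]
    rcases Int.units_eq_one_or (σ i) with hσ | hσ <;> simp [hσ] <;> ring
  have hflip : ∑ σ, T (-σ) = ∑ σ, T σ :=
    Fintype.sum_equiv (Equiv.neg (Fin n → ℤˣ)) _ T fun _ => rfl
  have htotal : 2 * ∑ σ, T σ = 2 ^ n * ∑ i, (v (q.1 i) - v (q.2 i)) := by
    rw [two_mul]
    nth_rw 2 [← hflip]
    rw [← Finset.sum_add_distrib, Finset.sum_congr rfl fun σ _ => hpair σ, Finset.sum_const,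
      Finset.card_univ, card_signs, nsmul_eq_mul]
    push_cast
    rfl
  field_simp
  exact htotal

variable [MeasurableSpace Z]

theorem rademacherSum_const_mul_le [Nonempty ι] {Q : Measure (Fin n → Z)} [IsProbabilityMeasure Q]
    {v : ι → Z → ℝ} (hv : ∀ k z, |v k z| ≤ b) {c : ℝ} (hc : 0 ≤ c) :
    rademacherSum Q (fun k z => c * v k z) ≤ c * rademacherSum Q v := by
  have hsup : ∀ σ : Fin n → ℤˣ,
      signedSup (fun k z => c * v k z) σ = fun z => c * signedSup v σ z := fun σ => by
    ext z
    simp only [signedSup, Real.mul_iSup_of_nonneg hc, Finset.mul_sum, mul_left_comm c]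
  simp only [rademacherSum]
  rw [mul_left_comm, Finset.mul_sum _ _ c]
  refine mul_le_mul_of_nonneg_left (Finset.sum_le_sum fun σ _ => ?_) (by positivity)
  rw [hsup]
  exact upperExpectation_const_mul_le (abs_signedSup_le hv σ) hc

theorem rademacherSum_comp_le {X : Type*} [MeasurableSpace X] [Nonempty ι] {P : Measure Z}
    {P' : Measure X} [IsProbabilityMeasure P] [IsProbabilityMeasure P'] {π : Z → X}
    (hπ : MeasurePreserving π P P') {v : ι → X → ℝ} (hv : ∀ k x, |v k x| ≤ b) :
    rademacherSum (Measure.pi fun _ : Fin n => P) (fun k z => v k (π z)) ≤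
      rademacherSum (Measure.pi fun _ : Fin n => P') v := by
  refine mul_le_mul_of_nonneg_left (Finset.sum_le_sum fun σ _ => ?_) (by positivity)
  exact upperExpectation_comp_le (measurePreserving_pi (fun _ => P) (fun _ => P') fun _ => hπ)
    (abs_signedSup_le hv σ)

theorem rademacherSum_add_le [Nonempty ι] {Q : Measure (Fin n → Z)} [IsProbabilityMeasure Q]
    {a : Z → ℝ} {v : ι → Z → ℝ} {b' : ℝ} (ha : Measurable a) (hab : ∀ z, |a z| ≤ b')
    (hv : ∀ k z, |v k z| ≤ b) :
    rademacherSum Q (fun k z => a z + v k z) ≤ rademacherSum Q v := by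
  have hai : ∀ i, Integrable (fun z : Fin n → Z => a (z i)) Q := fun i =>
    integrable_of_measurable_of_abs_le (ha.comp (measurable_pi_apply i)) fun z => hab (z i)
  have hsup : ∀ (σ : Fin n → ℤˣ), signedSup (fun k z => a z + v k z) σ =
      fun z => ∑ i, ((σ i : ℤ) : ℝ) * a (z i) + signedSup v σ z := fun σ => by
    ext z
    simp only [signedSup, mul_add, Finset.sum_add_distrib]
    exact (add_ciSup (bddAbove_range_of_abs_le fun k => abs_signed_sum_le (hv k) σ z) _).symm
  have hle : ∀ σ : Fin n → ℤˣ, upperExpectation Q (signedSup (fun k z => a z + v k z) σ) ≤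
      ∑ i, ((σ i : ℤ) : ℝ) * ∫ z, a (z i) ∂Q + upperExpectation Q (signedSup v σ) := fun σ => by
    have hσi : ∀ i, Integrable (fun z => ((σ i : ℤ) : ℝ) * a (z i)) Q := fun i =>
      (hai i).const_mul _
    rw [hsup]
    refine (upperExpectation_add_le (integrable_finsetSum _ fun i _ => hσi i)
      (abs_signedSup_le hv σ)).trans_eq ?_
    rw [integral_finsetSum _ fun i _ => hσi i]
    simp only [integral_const_mul]
  have hmean : ∑ σ : Fin n → ℤˣ, ∑ i, ((σ i : ℤ) : ℝ) * ∫ z, a (z i) ∂Q = 0 := by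
    rw [Finset.sum_comm]
    simp only [← Finset.sum_mul, sum_sign_eq_zero, zero_mul, Finset.sum_const_zero]
  refine mul_le_mul_of_nonneg_left ((Finset.sum_le_sum fun σ _ => hle σ).trans_eq ?_)
    (by positivity)
  rw [Finset.sum_add_distrib, hmean, zero_add]

theorem measurable_signWeight {d : Z → ℝ} (hd : Measurable d) (s : Fin n → ℤˣ) :
    Measurable fun z : Fin n → Z => signWeight (fun i => d (z i)) s := by
  unfold signWeight
  fun_prop

theorem rademacherSum_mul_le [Nonempty ι] {Q : Measure (Fin n → Z)} [IsProbabilityMeasure Q]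
    {d : Z → ℝ} (hd : Measurable d) (hd1 : ∀ z, |d z| ≤ 1) {u : ι → Z → ℝ}
    (hu : ∀ k z, |u k z| ≤ b) :
    rademacherSum Q (fun k z => d z * u k z) ≤ rademacherSum Q u := by
  choose g hg hgb using fun σ : Fin n → ℤˣ =>
    exists_isMeasurableCover (μ := Q) (abs_signedSup_le hu σ)
  have hw : ∀ (z : Fin n → Z) s, 0 ≤ signWeight (fun i => d (z i)) s :=
    fun z s => signWeight_nonneg (fun i => hd1 (z i)) s
  have hdu : ∀ k z, |d z * u k z| ≤ b := fun k z => by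
    rw [abs_mul]
    exact (mul_le_of_le_one_left (abs_nonneg _) (hd1 z)).trans (hu k z)
  set M := fun (σ : Fin n → ℤˣ) z => ∑ s, signWeight (fun i => d (z i)) s * g (σ * s) z
  have hMb : ∀ σ z, |M σ z| ≤ n * b := fun σ z => by
    calc |M σ z| ≤ ∑ s, |signWeight (fun i => d (z i)) s * g (σ * s) z| :=
          Finset.abs_sum_le_sum_abs _ _
      _ ≤ ∑ s, signWeight (fun i => d (z i)) s * (n * b) := by
          refine Finset.sum_le_sum fun s _ => ?_
          rw [abs_mul, abs_of_nonneg (hw z s)]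
          exact mul_le_mul_of_nonneg_left (hgb _ _) (hw z s)
      _ = n * b := by rw [← Finset.sum_mul, sum_signWeight, one_mul]
  have hMi : ∀ σ, Integrable (M σ) Q := fun σ => integrable_of_measurable_of_abs_le
    (Finset.measurable_sum _ fun s _ => (measurable_signWeight hd s).mul (hg _).measurable) (hMb σ)
  have hM : ∀ σ, upperExpectation Q (signedSup (fun k z => d z * u k z) σ) ≤ ∫ z, M σ z ∂Q :=
    fun σ => upperExpectation_le_integral (integrable_const (-(n * b)))
      (fun z => neg_le_of_abs_le (abs_signedSup_le hdu σ z)) (hMi σ)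
      fun z => (signedSup_mul_le hd1 hu σ z).trans (Finset.sum_le_sum fun s _ =>
        mul_le_mul_of_nonneg_left ((hg _).le z) (hw z s))
  refine mul_le_mul_of_nonneg_left ((Finset.sum_le_sum fun σ _ => hM σ).trans_eq ?_)
    (by positivity)
  rw [← integral_finsetSum _ fun σ _ => hMi σ]
  simp only [M, fun z => sum_sum_signWeight_mul (fun i => d (z i)) fun σ => g σ z]
  rw [integral_finsetSum _ fun σ _ => integrable_of_measurable_of_abs_le (hg σ).measurable (hgb σ)]
  exact Finset.sum_congr rfl fun σ _ => (hg σ).integral_eq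

theorem measurePreserving_mixSample (P : Measure Z) [IsProbabilityMeasure P] (σ : Fin n → ℤˣ) :
    MeasurePreserving (mixSample σ)
      ((Measure.pi fun _ : Fin n => P).prod (Measure.pi fun _ : Fin n => P))
      (Measure.pi fun _ : Fin n => P) := by
  have hmeas : Measurable (mixSample (Z := Z) σ) := by
    refine measurable_pi_lambda _ fun i => ?_
    unfold mixSample
    split_ifs <;> fun_prop
  refine ⟨hmeas, (Measure.pi_eq fun s hs => ?_).symm⟩
  have hpre : mixSample σ ⁻¹' Set.univ.pi s =
      (Set.univ.pi fun i => if σ i = 1 then s i else Set.univ) ×ˢ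
        (Set.univ.pi fun i => if σ i = 1 then Set.univ else s i) := by
    ext q
    simp only [Set.mem_preimage, Set.mem_pi, Set.mem_univ, true_imp_iff, Set.mem_prod, mixSample,
      ← forall_and]
    refine forall_congr' fun i => ?_
    split_ifs <;> simp
  rw [Measure.map_apply hmeas (MeasurableSet.univ_pi hs), hpre, Measure.prod_prod, Measure.pi_pi,
    Measure.pi_pi, ← Finset.prod_mul_distrib]
  refine Finset.prod_congr rfl fun i _ => ?_
  split_ifs <;> simp

theorem sum_sub_integral_eq {P : Measure Z} [IsProbabilityMeasure P] {v : Z → ℝ}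
    (hv : Integrable v P) (z : Fin n → Z) :
    ∑ i, (v (z i) - ∫ y, v y ∂P) =
      ∫ z', ∑ i, (v (z i) - v (z' i)) ∂Measure.pi fun _ : Fin n => P := by
  have hvi : ∀ i, Integrable (fun z' : Fin n → Z => v (z' i)) (Measure.pi fun _ => P) :=
    fun i => integrable_comp_eval hv
  rw [integral_finsetSum (f := fun i (z' : Fin n → Z) => v (z i) - v (z' i)) _
    fun i _ => (integrable_const _).sub (hvi i)]
  refine Finset.sum_congr rfl fun i _ => ?_
  rw [integral_sub (integrable_const _) (hvi i),
    integral_comp_eval (i := i) (μ := fun _ => P) hv.aestronglyMeasurable]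
  simp

theorem ciSup_sum_sub_integral_le [Nonempty ι] {P : Measure Z} [IsProbabilityMeasure P]
    {v : ι → Z → ℝ} (hv : ∀ k, Integrable (v k) P) {z : Fin n → Z} {w : (Fin n → Z) → ℝ}
    (hw : Integrable w (Measure.pi fun _ : Fin n => P))
    (hle : ∀ k z', ∑ i, (v k (z i) - v k (z' i)) ≤ w z') :
    ⨆ k, ∑ i, (v k (z i) - ∫ y, v k y ∂P) ≤ ∫ z', w z' ∂Measure.pi fun _ : Fin n => P := by
  refine ciSup_le fun k => ?_
  rw [sum_sub_integral_eq (hv k)]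
  exact integral_mono (integrable_finsetSum _ fun i _ =>
    (integrable_const _).sub (integrable_comp_eval (hv k))) hw (hle k)

theorem abs_sum_sub_integral_le {P : Measure Z} [IsProbabilityMeasure P] {v : Z → ℝ}
    (hv : ∀ z, |v z| ≤ b) (z : Fin n → Z) : |∑ i, (v (z i) - ∫ y, v y ∂P)| ≤ n * (2 * b) :=
  abs_sum_fin_le fun i => by
    linarith [abs_sub (v (z i)) (∫ y, v y ∂P), hv (z i), abs_integral_le_of_abs_le (μ := P) hv]

theorem upperExpectation_ciSup_sum_sub_integral_le [Nonempty ι] {P : Measure Z}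
    [IsProbabilityMeasure P] {v : ι → Z → ℝ} (hv : ∀ k, Measurable (v k))
    (hvb : ∀ k z, |v k z| ≤ b) :
    upperExpectation (Measure.pi fun _ : Fin n => P)
        (fun z => ⨆ k, ∑ i, (v k (z i) - ∫ y, v k y ∂P)) ≤
      2 * rademacherSum (Measure.pi fun _ : Fin n => P) v := by
  set Q := Measure.pi fun _ : Fin n => P
  choose g hg hgb using fun σ : Fin n → ℤˣ =>
    exists_isMeasurableCover (μ := Q) (abs_signedSup_le hvb σ)
  have hmix := measurePreserving_mixSample (n := n) P
  have hgm : ∀ σ, Measurable fun q => g σ (mixSample σ q) := fun σ =>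
    (hg σ).measurable.comp (hmix σ).measurable
  set W := fun q => 2 * (1 / (2 : ℝ) ^ n * ∑ σ, g σ (mixSample σ q)) with hW
  have hgi : ∀ σ, Integrable (fun q => g σ (mixSample σ q)) (Q.prod Q) := fun σ =>
    integrable_of_measurable_of_abs_le (hgm σ) fun q => hgb σ _
  have hWi : Integrable W (Q.prod Q) :=
    ((integrable_finsetSum _ fun σ _ => hgi σ).const_mul _).const_mul _
  have hWz : ∀ z, Integrable (fun z' => W (z, z')) Q := fun z =>
    ((integrable_finsetSum _ fun σ _ => integrable_of_measurable_of_abs_le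
      ((hgm σ).comp measurable_prodMk_left) fun z' => hgb σ _).const_mul _).const_mul _
  have hdom : ∀ k q, ∑ i, (v k (q.1 i) - v k (q.2 i)) ≤ W q := fun k q => by
    rw [← mean_signed_sum_mixSample (v k) q]
    simp only [hW]
    gcongr with σ
    exact (le_signedSup hvb k σ _).trans ((hg σ).le _)
  have hU : ∀ z, ⨆ k, ∑ i, (v k (z i) - ∫ y, v k y ∂P) ≤ ∫ z', W (z, z') ∂Q := fun z =>
    ciSup_sum_sub_integral_le (fun k => integrable_of_measurable_of_abs_le (hv k) (hvb k)) (hWz z)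
      fun k z' => hdom k (z, z')
  have hmean : ∀ σ, ∫ q, g σ (mixSample σ q) ∂Q.prod Q = upperExpectation Q (signedSup v σ) :=
    fun σ => (hg σ).integral_comp (hmix σ)
  calc upperExpectation Q (fun z => ⨆ k, ∑ i, (v k (z i) - ∫ y, v k y ∂P))
      ≤ ∫ z, ∫ z', W (z, z') ∂Q ∂Q :=
        upperExpectation_le_integral (integrable_const (-(n * (2 * b))))
          (fun z => neg_le_of_abs_le (abs_ciSup_le_of_abs_le fun k =>
            abs_sum_sub_integral_le (hvb k) z)) hWi.integral_prod_left hU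
    _ = 2 * (1 / (2 : ℝ) ^ n * ∑ σ, ∫ q, g σ (mixSample σ q) ∂Q.prod Q) := by
        rw [← integral_prod W hWi, hW, integral_const_mul, integral_const_mul,
          integral_finsetSum _ fun σ _ => hgi σ]
    _ = 2 * rademacherSum Q v := by
        simp only [hmean, rademacherSum]

end RademacherSum

section UniformDeviation

variable {ι Z : Type*} {n : ℕ} {b η : ℝ}

theorem ciSup_sum_le_ciSup_sum_update_add [Nonempty ι] {w : ι → Z → ℝ} {c : ℝ}
    (hw : ∀ k z, |w k z| ≤ b) (hc : ∀ k z y, w k z ≤ w k y + c) (i : Fin n) (z : Fin n → Z)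
    (y : Z) :
    ⨆ k, ∑ j, w k (z j) ≤ (⨆ k, ∑ j, w k (Function.update z i y j)) + c := by
  have hbdd : BddAbove (Set.range fun k => ∑ j, w k (Function.update z i y j)) :=
    bddAbove_range_of_abs_le fun k => abs_sum_fin_le fun j => hw k _
  refine ciSup_le fun k => le_trans ?_ (add_le_add_left (le_ciSup hbdd k) c)
  rw [← sub_le_iff_le_add', ← Finset.sum_sub_distrib, Fintype.sum_eq_single i]
  · rw [Function.update_self, sub_le_iff_le_add']
    exact hc k _ _
  · intro j hj
    rw [Function.update_of_ne hj, sub_self]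

variable [MeasurableSpace Z] {P : Measure Z} [IsProbabilityMeasure P]

theorem holdsWithProb_sum_sub_integral_le {v : ι → Z → ℝ} (hv : ∀ k, Measurable (v k))
    (hb0 : 0 < b) (hvb : ∀ k z, |v k z| ≤ b) (hn : 1 ≤ n) (hη0 : 0 < η) (hη1 : η ≤ 1) :
    HoldsWithProb (Measure.pi fun _ : Fin n => P) η fun D =>
      ∀ k, ∑ i, (v k (D i) - ∫ z, v k z ∂P) ≤
        2 * rademacherSum (Measure.pi fun _ : Fin n => P) v +
          n * b * √(2 * Real.log (1 / η) / n) := by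
  rcases isEmpty_or_nonempty ι with _ | _
  · exact ⟨Set.univ, .univ, by simp [hη0.le], fun _ _ => isEmptyElim⟩
  have hn0 : (0 : ℝ) < n := by exact_mod_cast hn
  set r := √(2 * Real.log (1 / η) / n)
  have hr : r ^ 2 = 2 * Real.log (1 / η) / n :=
    Real.sq_sqrt (div_nonneg (mul_nonneg zero_le_two
      (Real.log_nonneg ((one_le_div hη0).2 hη1))) hn0.le)
  set w := fun k z => v k z - ∫ y, v k y ∂P
  have hwb : ∀ k z, |w k z| ≤ 2 * b := fun k z => by
    linarith [abs_sub (v k z) (∫ y, v k y ∂P), hvb k z,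
      abs_integral_le_of_abs_le (μ := P) (hvb k)]
  have hwd : ∀ k z y, w k z ≤ w k y + 2 * b := fun k z y => by
    linarith [le_of_abs_le (hvb k z), neg_le_of_abs_le (hvb k y)]
  have hexp : -(n * b * r) ^ 2 / (2 * ∑ _i : Fin n, (2 * b / 2) ^ 2) = Real.log η := by
    rw [mul_pow, hr, one_div, Real.log_inv, Finset.sum_const, Finset.card_univ, Fintype.card_fin,
      nsmul_eq_mul]
    field_simp
  have hconc := holdsWithProb_le_upperExpectation_add (μ := fun _ : Fin n => P)
    (f := fun D => ⨆ k, ∑ i, w k (D i)) (c := fun _ => ⟨2 * b, by positivity⟩) (s := n * b * r)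
    (fun D => abs_ciSup_le_of_abs_le fun k => abs_sum_fin_le fun i => hwb k (D i))
    (by positivity) fun i D y => ciSup_sum_le_ciSup_sum_update_add hwb hwd i D y
  change HoldsWithProb _ (Real.exp (-(n * b * r) ^ 2 / (2 * ∑ _i : Fin n, (2 * b / 2) ^ 2))) _
    at hconc
  rw [hexp, Real.exp_log hη0] at hconc
  refine hconc.mono fun D hD k => ?_
  calc ∑ i, w k (D i) ≤ ⨆ k, ∑ i, w k (D i) :=
        le_ciSup (bddAbove_range_of_abs_le fun k => abs_sum_fin_le fun i => hwb k (D i)) k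
    _ ≤ _ := hD
    _ ≤ _ := add_le_add_left (upperExpectation_ciSup_sum_sub_integral_le hv hvb) _

theorem abs_val_le_one (y : Bool) : |val y| ≤ 1 := by
  cases y <;> simp [val]

variable {X : Type*} [MeasurableSpace X] {π : Z → X} {H : Set (X → Bool)}

theorem rademacherSum_val_le (hπ : Measurable π) [Nonempty H] (hn : 1 ≤ n) :
    rademacherSum (Measure.pi fun _ : Fin n => P) (fun (h : H) z => val (h.1 (π z))) ≤
      n * rademacherComplexity (P.map π) H n := by
  have := Measure.isProbabilityMeasure_map (μ := P) hπ.aemeasurable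
  have hn0 : (n : ℝ) ≠ 0 := by positivity
  have hmean : rademacherComplexity (P.map π) H n =
      rademacherSum (Measure.pi fun _ : Fin n => P.map π)
        (fun (h : H) x => 1 / (n : ℝ) * val (h.1 x)) := by
    simp only [rademacherComplexity, rademacherSum, Finset.mul_sum, mul_left_comm]
    rfl
  have hval : ∀ (h : H) x, |1 / (n : ℝ) * val (h.1 x)| ≤ 1 / n := fun h x => by
    rw [abs_mul, abs_of_nonneg (by positivity)]
    exact mul_le_of_le_one_right (by positivity) (abs_val_le_one _)
  calc rademacherSum (Measure.pi fun _ : Fin n => P) (fun (h : H) z => val (h.1 (π z)))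
      ≤ rademacherSum (Measure.pi fun _ : Fin n => P.map π) (fun (h : H) x => val (h.1 x)) :=
        rademacherSum_comp_le ⟨hπ, rfl⟩ (v := fun (h : H) x => val (h.1 x))
          fun h x => abs_val_le_one (h.1 x)
    _ = rademacherSum (Measure.pi fun _ : Fin n => P.map π)
          (fun (h : H) x => n * (1 / (n : ℝ) * val (h.1 x))) := by
        simp only [← mul_assoc, mul_one_div_cancel hn0, one_mul]
    _ ≤ n * rademacherComplexity (P.map π) H n := by
        rw [hmean]
        exact rademacherSum_const_mul_le hval (Nat.cast_nonneg n)

theorem rademacherSum_apply_prediction_le (hπ : Measurable π) [Nonempty H] (hn : 1 ≤ n)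
    {φ : Z → Bool → ℝ} (hφ : ∀ y, Measurable fun z => φ z y) (hb0 : 0 < b)
    (hb : ∀ z y, |φ z y| ≤ b) :
    rademacherSum (Measure.pi fun _ : Fin n => P) (fun (h : H) z => φ z (h.1 (π z))) ≤
      2 * b * (n * rademacherComplexity (P.map π) H n) := by
  set d := fun z => (φ z true - φ z false) / (2 * b)
  have hd : Measurable d := ((hφ true).sub (hφ false)).div_const _
  have hd1 : ∀ z, |d z| ≤ 1 := fun z => by
    rw [abs_div, abs_of_pos (by positivity : 0 < 2 * b), div_le_one (by positivity)]
    linarith [abs_sub (φ z true) (φ z false), hb z true, hb z false]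
  have hval : ∀ (h : H) z, |2 * b * val (h.1 (π z))| ≤ 2 * b := fun h z => by
    rw [abs_mul, abs_of_pos (by positivity : 0 < 2 * b)]
    exact mul_le_of_le_one_right (by positivity) (abs_val_le_one _)
  have hdval : ∀ (h : H) z, |d z * (2 * b * val (h.1 (π z)))| ≤ 2 * b := fun h z => by
    rw [abs_mul]
    exact (mul_le_of_le_one_left (abs_nonneg _) (hd1 z)).trans (hval h z)
  have hdecomp : ∀ z y, φ z y = φ z false + d z * (2 * b * val y) := fun z y => by
    cases y
    · simp [val]
    · simp only [d, val, if_true]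
      field_simp
      ring
  calc rademacherSum (Measure.pi fun _ : Fin n => P) (fun (h : H) z => φ z (h.1 (π z)))
      = rademacherSum (Measure.pi fun _ : Fin n => P)
          (fun (h : H) z => φ z false + d z * (2 * b * val (h.1 (π z)))) := by
        simp only [← hdecomp]
    _ ≤ rademacherSum (Measure.pi fun _ : Fin n => P)
          (fun (h : H) z => d z * (2 * b * val (h.1 (π z)))) :=
        rademacherSum_add_le (v := fun (h : H) z => d z * (2 * b * val (h.1 (π z)))) (hφ false)
          (fun z => hb z false) hdval
    _ ≤ rademacherSum (Measure.pi fun _ : Fin n => P)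
          (fun (h : H) z => 2 * b * val (h.1 (π z))) :=
        rademacherSum_mul_le (u := fun (h : H) z => 2 * b * val (h.1 (π z))) hd hd1 hval
    _ ≤ 2 * b * rademacherSum (Measure.pi fun _ : Fin n => P)
          (fun (h : H) z => val (h.1 (π z))) :=
        rademacherSum_const_mul_le (v := fun (h : H) z => val (h.1 (π z)))
          (fun h z => abs_val_le_one (h.1 (π z))) (by positivity)
    _ ≤ 2 * b * (n * rademacherComplexity (P.map π) H n) :=
        mul_le_mul_of_nonneg_left (rademacherSum_val_le hπ hn) (by positivity)

theorem measurable_apply_prediction {φ : Z → Bool → ℝ} (hφ : ∀ y, Measurable fun z => φ z y)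
    {k : Z → Bool} (hk : Measurable k) : Measurable fun z => φ z (k z) :=
  (measurable_from_prod_countable_left (f := fun q : Z × Bool => φ q.1 q.2) hφ).comp
    (measurable_id.prodMk hk)

theorem holdsWithProb_mean_sub_integral_le (hπ : Measurable π) (hH : ∀ h ∈ H, Measurable h)
    (hn : 1 ≤ n) {φ : Z → Bool → ℝ} (hφ : ∀ y, Measurable fun z => φ z y) (hb0 : 0 < b)
    (hb : ∀ z y, |φ z y| ≤ b) (hη0 : 0 < η) (hη1 : η ≤ 1) :
    HoldsWithProb (Measure.pi fun _ : Fin n => P) η fun D =>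
      ∀ h ∈ H, (∑ i, φ (D i) (h (π (D i)))) / n - ∫ z, φ z (h (π z)) ∂P ≤
        4 * b * rademacherComplexity (P.map π) H n + b * √(2 * Real.log (1 / η) / n) := by
  have hn0 : (0 : ℝ) < n := by exact_mod_cast hn
  refine (holdsWithProb_sum_sub_integral_le (v := fun (h : H) z => φ z (h.1 (π z)))
    (fun h => measurable_apply_prediction hφ ((hH h.1 h.2).comp hπ)) hb0 (fun h z => hb z _)
    hn hη0 hη1).mono fun D hD h hh => ?_
  have : Nonempty H := ⟨h, hh⟩
  have hsum := (hD ⟨h, hh⟩).trans (add_le_add_left (mul_le_mul_of_nonneg_left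
    (rademacherSum_apply_prediction_le hπ hn hφ hb0 hb) zero_le_two) _)
  rw [Finset.sum_sub_distrib, Finset.sum_const, Finset.card_univ, Fintype.card_fin,
    nsmul_eq_mul] at hsum
  rw [div_sub' hn0.ne', div_le_iff₀ hn0]
  linarith

theorem holdsWithProb_abs_mean_sub_integral_le {κ : Type*} [Fintype κ] [Nonempty κ]
    (hπ : Measurable π) (hH : ∀ h ∈ H, Measurable h) (hn : 1 ≤ n) {φ : κ → Z → Bool → ℝ}
    (hφ : ∀ k y, Measurable fun z => φ k z y) (hb0 : 0 < b) (hb : ∀ k z y, |φ k z y| ≤ b)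
    (hη0 : 0 < η) (hη1 : η ≤ 1) :
    HoldsWithProb (Measure.pi fun _ : Fin n => P) η fun D => ∀ h ∈ H, ∀ k,
      |(∑ i, φ k (D i) (h (π (D i)))) / n - ∫ z, φ k z (h (π z)) ∂P| ≤
        4 * b * rademacherComplexity (P.map π) H n +
          b * √(2 * Real.log (2 * Fintype.card κ / η) / n) := by
  have hκ : (1 : ℝ) ≤ Fintype.card κ := by exact_mod_cast Fintype.card_pos (α := κ)
  have hη' : 0 < η / (2 * Fintype.card κ) := by positivity
  have hη'1 : η / (2 * Fintype.card κ) ≤ 1 := (div_le_one (by positivity)).2 (by linarith)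
  have hsigned := HoldsWithProb.forall fun q : κ × ℤˣ =>
    holdsWithProb_mean_sub_integral_le (P := P) hπ hH hn
      (φ := fun z y => ((q.2 : ℤ) : ℝ) * φ q.1 z y) (fun y => (hφ q.1 y).const_mul _) hb0
      (fun z y => (abs_unit_mul q.2 _).trans_le (hb q.1 z y)) hη' hη'1
  have hunion : ∑ _q : κ × ℤˣ, η / (2 * Fintype.card κ) = η := by
    rw [Finset.sum_const, Finset.card_univ, Fintype.card_prod, Fintype.card_units_int, nsmul_eq_mul]
    push_cast
    field_simp
  rw [hunion] at hsigned
  refine hsigned.mono fun D hD h hh k => ?_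
  have hupper := hD (k, 1) h hh
  have hlower := hD (k, -1) h hh
  simp only [Units.val_one, Units.val_neg, Int.cast_one, Int.cast_neg, one_mul, neg_one_mul,
    Finset.sum_neg_distrib, neg_div, integral_neg, one_div_div] at hupper hlower
  exact abs_le.2 ⟨by linarith, hupper⟩

end UniformDeviation

section FairClassification

variable {X A : Type*} {n : ℕ} {D : Fin n → X × A × Bool}

theorem empAcc_le_one (h : X → Bool) : empAcc D h ≤ 1 := by
  refine div_le_one_of_le₀ ?_ (Nat.cast_nonneg n)
  refine (Finset.sum_le_card_nsmul _ _ 1 fun i _ => ?_).trans (by simp)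
  split_ifs <;> simp

variable [MeasurableSpace X] [MeasurableSpace A] {m : ℕ} {L : ℝ≥0} {b p : ℝ}
  {P : Measure (X × A × Bool)} {F : FairnessMetric X A m} {H : Set (X → Bool)}

theorem measurableSet_correct {h : X → Bool} (hh : Measurable h) :
    MeasurableSet {z : X × A × Bool | h z.1 = z.2.2} :=
  measurableSet_eq_fun (hh.comp measurable_fst) measurable_snd.snd

theorem acc_eq_integral {h : X → Bool} (hh : Measurable h) :
    acc P h = ∫ z, (if h z.1 = z.2.2 then (1 : ℝ) else 0) ∂P := by
  rw [acc, ← integral_indicator_one (measurableSet_correct hh)]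
  simp only [Set.indicator_apply, Set.mem_ofPred_eq, Pi.one_apply]

theorem ae_empAcc_eq_one [IsProbabilityMeasure P] {h : X → Bool} (hh : Measurable h)
    (h1 : 1 ≤ acc P h) (hn : 1 ≤ n) : ∀ᵐ D ∂Measure.pi fun _ : Fin n => P, empAcc D h = 1 := by
  have hcorrect : ∀ᵐ z ∂P, h z.1 = z.2.2 := by
    have hcompl := probReal_compl_eq_one_sub (μ := P) (measurableSet_correct hh)
    have hone : P.real {z | h z.1 = z.2.2} = 1 := le_antisymm measureReal_le_one h1
    rw [hone, sub_self, measureReal_eq_zero_iff] at hcompl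
    exact hcompl
  have hall : ∀ᵐ D ∂Measure.pi fun _ : Fin n => P, ∀ i, h (D i).1 = (D i).2.2 :=
    ae_all_iff.2 fun i =>
      (measurePreserving_eval (fun _ : Fin n => P) i).quasiMeasurePreserving.ae hcorrect
  filter_upwards [hall] with D hD
  have hn0 : (n : ℝ) ≠ 0 := by positivity
  simp [empAcc, hD, hn0]

theorem ae_exists_empirically_perfect [IsProbabilityMeasure P] (hH : ∀ h ∈ H, Measurable h)
    (hn : 1 ≤ n) :
    ∀ᵐ D ∂Measure.pi fun _ : Fin n => P, ∀ k ∈ H, 1 ≤ acc P k → ∀ r, fair P F k < r →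
      ∃ k' ∈ H, empAcc D k' = 1 ∧ fair P F k' < r := by
  have hrat : ∀ᵐ D ∂Measure.pi fun _ : Fin n => P, ∀ q : ℚ,
      (∃ k ∈ H, 1 ≤ acc P k ∧ fair P F k < q) → ∃ k' ∈ H, empAcc D k' = 1 ∧ fair P F k' < q := by
    refine ae_all_iff.2 fun q => ?_
    by_cases hq : ∃ k ∈ H, 1 ≤ acc P k ∧ fair P F k < q
    · obtain ⟨k, hk, hk1, hkq⟩ := hq
      filter_upwards [ae_empAcc_eq_one (hH k hk) hk1 hn] with D hD _ using ⟨k, hk, hD, hkq⟩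
    · exact .of_forall fun D hD => absurd hD hq
  filter_upwards [hrat] with D hD k hk hk1 r hkr
  obtain ⟨q, hkq, hqr⟩ := exists_rat_btwn hkr
  obtain ⟨k', hk', hk'1, hk'q⟩ := hD q ⟨k, hk, hk1, hkq⟩
  exact ⟨k', hk', hk'1, hk'q.trans hqr⟩

theorem le_tradeoff {ψ a : ℝ} (ha : a ≤ 1) (h : ∀ k ∈ H, ψ ≤ acc P k → a ≤ fair P F k) :
    a ≤ tradeoff P F H ψ := by
  unfold tradeoff
  split_ifs with hex
  · obtain ⟨k, hk, hψ⟩ := hex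
    exact le_csInf ⟨_, k, ⟨hk, hψ⟩, rfl⟩ (Set.forall_mem_image.2 fun k hk => h k hk.1 hk.2)
  · exact ha

theorem gap_le_of_uniform_close [IsProbabilityMeasure P] (hfair : ∀ h ∈ H, fair P F h ≤ 1)
    (hLip : LipschitzOnWith L (tradeoff P F H) (Set.Icc 0 1)) {α β δ : ℝ}
    (hα : ∀ h ∈ H, |empAcc D h - acc P h| ≤ α) (hβ : ∀ h ∈ H, |empFair F D h - fair P F h| ≤ β)
    (hperfect : ∀ k ∈ H, 1 ≤ acc P k → ∀ r, fair P F k < r →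
      ∃ k' ∈ H, empAcc D k' = 1 ∧ fair P F k' < r)
    {h : X → Bool} (hmin : IsEmpiricalMinimiser F H δ D h) :
    gap P F H h ≤ L * (2 * α) + 2 * β := by
  obtain ⟨⟨hH, hδ⟩, hopt⟩ := hmin
  have hα0 : 0 ≤ α := (abs_nonneg _).trans (hα h hH)
  have hβ0 : 0 ≤ β := (abs_nonneg _).trans (hβ h hH)
  have hacc0 : 0 ≤ acc P h := measureReal_nonneg
  have hacc1 : acc P h ≤ 1 := measureReal_le_one
  have hcompare : ∀ k ∈ H, empAcc D h ≤ empAcc D k → fair P F h - 2 * β ≤ fair P F k :=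
    fun k hk hle => by
      linarith [neg_le_of_abs_le (hβ h hH), le_of_abs_le (hβ k hk), hopt k hk (hδ.trans hle)]
  set ψ := min 1 (acc P h + 2 * α)
  have hψ : ψ ∈ Set.Icc (0 : ℝ) 1 := ⟨le_min zero_le_one (by linarith), min_le_left _ _⟩
  have hψdist : |ψ - acc P h| ≤ 2 * α := by
    rw [abs_of_nonneg (sub_nonneg.2 (le_min hacc1 (by linarith)))]
    linarith [min_le_right 1 (acc P h + 2 * α)]
  have hcompetitor : fair P F h - 2 * β ≤ tradeoff P F H ψ := by
    refine le_tradeoff (by linarith [hfair h hH]) fun k hk hψk => ?_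
    rcases min_le_iff.1 hψk with hk1 | hk2
    · refine le_of_forall_gt fun r hr => ?_
      obtain ⟨k', hk', hk'1, hk'r⟩ := hperfect k hk hk1 r hr
      exact (hcompare k' hk' (hk'1 ▸ empAcc_le_one h)).trans_lt hk'r
    · exact hcompare k hk
        (by linarith [le_of_abs_le (hα h hH), neg_le_of_abs_le (hα k hk)])
  have hτ : tradeoff P F H ψ - tradeoff P F H (acc P h) ≤ L * (2 * α) :=
    (le_abs_self _).trans ((hLip.dist_le_mul ψ hψ _ ⟨hacc0, hacc1⟩).trans
      (mul_le_mul_of_nonneg_left hψdist L.2))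
  unfold gap
  linarith

theorem abs_div_sub_div_le {q q' r r' ε : ℝ} (hp : 0 < p) (hr : p ≤ r) (hq : |q' - q| ≤ ε)
    (hr' : |r' - r| ≤ ε) (hb0 : 0 ≤ b) (hr'0 : 0 ≤ r') (hb : |q'| ≤ b * r') :
    |q' / r' - q / r| ≤ ε * (1 + b) / p := by
  have hr0 : 0 < r := hp.trans_le hr
  have hε : 0 ≤ ε := (abs_nonneg _).trans hq
  have hratio : |q' / r'| ≤ b := by
    rw [abs_div, abs_of_nonneg hr'0]
    exact div_le_of_le_mul₀ hr'0 hb0 hb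
  have hmul : q' / r' * r' = q' := div_mul_cancel_of_imp fun h => by
    rwa [h, mul_zero, abs_nonpos_iff] at hb
  have hdiff : q' / r' - q / r = (q' - q + q' / r' * (r - r')) / r := by
    rw [mul_sub, hmul]
    field_simp
    ring
  have hnum : |q' - q + q' / r' * (r - r')| ≤ ε * (1 + b) := by
    rw [abs_sub_comm] at hr'
    calc |q' - q + q' / r' * (r - r')| ≤ |q' - q| + |q' / r'| * |r - r'| :=
          (abs_add_le _ _).trans_eq (by rw [abs_mul])
      _ ≤ ε + b * ε := by gcongr
      _ = ε * (1 + b) := by ring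
  rw [hdiff, abs_div, abs_of_pos hr0]
  gcongr

theorem integral_cond_eq_div {Ω : Type*} [MeasurableSpace Ω] (μ : Measure Ω) {s : Set Ω}
    (hs : MeasurableSet s) (f : Ω → ℝ) :
    ∫ ω, f ω ∂ProbabilityTheory.cond μ s = (∫ ω, s.indicator f ω ∂μ) / μ.real s := by
  rw [ProbabilityTheory.cond, integral_smul_measure, integral_indicator hs, ENNReal.toReal_inv,
    smul_eq_mul, div_eq_inv_mul, Measure.real]

open Classical in
theorem abs_empFair_sub_fair_le {ε : ℝ} (hb0 : 0 ≤ b) (hb : ∀ j z y, |F.g j z y| ≤ b)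
    (hp : 0 < p) (hpe : ∀ j, p ≤ P.real (F.event j)) (hn : 1 ≤ n) {h : X → Bool}
    (hq : ∀ j, |(∑ i, if D i ∈ F.event j then F.g j (D i) (h (D i).1) else 0) / n -
      ∫ z, (F.event j).indicator (fun z => F.g j z (h z.1)) z ∂P| ≤ ε)
    (hr : ∀ j, |(∑ i, if D i ∈ F.event j then (1 : ℝ) else 0) / n - P.real (F.event j)| ≤ ε) :
    |empFair F D h - fair P F h| ≤ m * (ε * (1 + b) / p) := by
  have hn0 : (0 : ℝ) < n := by exact_mod_cast hn
  refine (abs_abs_sub_abs_le _ _).trans ?_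
  rw [← Finset.sum_sub_distrib]
  refine abs_sum_fin_le fun j => ?_
  rw [integral_cond_eq_div P (F.measurableSet_event j), ← div_div_div_cancel_right₀ hn0.ne']
  refine abs_div_sub_div_le hp (hpe j) (hq j) (hr j) hb0
    (div_nonneg (Finset.sum_nonneg fun i _ => by split_ifs <;> simp) hn0.le) ?_
  rw [abs_div, abs_of_pos hn0, ← mul_div_assoc, Finset.mul_sum]
  gcongr
  refine (Finset.abs_sum_le_sum_abs _ _).trans (Finset.sum_le_sum fun i _ => ?_)
  split_ifs
  · simpa using hb j _ _
  · simp

open Classical in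
/-- The functions of the data point and the prediction whose empirical means determine the
empirical accuracy (`none`) and the numerators (`inl`) and denominators (`inr`) of the averages in
the empirical fairness violation. -/
noncomputable def statistic (F : FairnessMetric X A m) :
    Option (Fin m ⊕ Fin m) → X × A × Bool → Bool → ℝ
  | none, z, y => if y = z.2.2 then 1 else 0
  | some (.inl j), z, y => if z ∈ F.event j then F.g j z y else 0
  | some (.inr j), z, _ => if z ∈ F.event j then 1 else 0

theorem measurable_statistic (k : Option (Fin m ⊕ Fin m)) (y : Bool) :
    Measurable fun z => statistic F k z y :=
  match k with
  | none => .ite (measurableSet_correct (h := fun _ => y) measurable_const) measurable_const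
      measurable_const
  | some (.inl j) => .ite (F.measurableSet_event j) (F.measurable_g j y) measurable_const
  | some (.inr j) => .ite (F.measurableSet_event j) measurable_const measurable_const

theorem abs_statistic_le (hb1 : 1 ≤ b) (hb : ∀ j z y, |F.g j z y| ≤ b)
    (k : Option (Fin m ⊕ Fin m)) (z : X × A × Bool) (y : Bool) : |statistic F k z y| ≤ b := by
  have hb0 : 0 ≤ b := zero_le_one.trans hb1
  rcases k with _ | j | j <;> simp only [statistic] <;> split_ifs <;> simp [hb0, hb1, hb]

theorem holdsWithProb_gap_le [IsProbabilityMeasure P] (hH : ∀ h ∈ H, Measurable h)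
    (hb1 : 1 ≤ b) (hb : ∀ j z y, |F.g j z y| ≤ b) (hp : 0 < p)
    (hpe : ∀ j, p ≤ P.real (F.event j)) (hfair : ∀ h ∈ H, fair P F h ≤ 1)
    (hLip : LipschitzOnWith L (tradeoff P F H) (Set.Icc 0 1)) (hn : 1 ≤ n) {η : ℝ}
    (hη0 : 0 < η) (hη1 : η ≤ 1) (δ : ℝ) :
    HoldsWithProb (Measure.pi fun _ : Fin n => P) η fun D =>
      ∀ h, IsEmpiricalMinimiser F H δ D h → gap P F H h ≤
        (2 * L + 2 * m * (1 + b) / p) * (4 * b * rademacherComplexity (P.map Prod.fst) H n +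
          b * √(2 * Real.log ((4 * m + 2) / η) / n)) := by
  have hb0 : 0 < b := zero_lt_one.trans_le hb1
  have hclose := holdsWithProb_abs_mean_sub_integral_le (P := P) measurable_fst hH hn
    (measurable_statistic (F := F)) hb0 (abs_statistic_le hb1 hb) hη0 hη1
  have hcard : 2 * (Fintype.card (Option (Fin m ⊕ Fin m)) : ℝ) = 4 * m + 2 := by
    rw [Fintype.card_option, Fintype.card_sum, Fintype.card_fin]
    push_cast
    ring
  rw [hcard] at hclose
  refine (hclose.and_ae (ae_exists_empirically_perfect (F := F) hH hn)).mono
    fun D ⟨hD, hperfect⟩ h hmin => ?_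
  set ε := 4 * b * rademacherComplexity (P.map Prod.fst) H n +
    b * √(2 * Real.log ((4 * m + 2) / η) / n)
  have hacc : ∀ h ∈ H, |empAcc D h - acc P h| ≤ ε := fun h hh => by
    rw [acc_eq_integral (hH h hh)]
    exact hD h hh none
  have hempFair : ∀ h ∈ H, |empFair F D h - fair P F h| ≤ m * (ε * (1 + b) / p) := fun h hh => by
    refine abs_empFair_sub_fair_le hb0.le hb hp hpe hn (fun j => ?_) fun j => ?_
    · exact hD h hh (some (.inl j))
    · rw [← integral_indicator_one (F.measurableSet_event j)]
      exact hD h hh (some (.inr j))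
  refine (gap_le_of_uniform_close hfair hLip hacc hempFair hperfect hmin).trans_eq ?_
  ring

theorem sqrt_log_div_le {N η γ : ℝ} (hN : 1 ≤ N) (hη0 : 0 < η) (hη1 : η ≤ 1) (hγ : γ ≤ 1 / 2)
    (hn : 1 ≤ n) :
    √(2 * Real.log (N / η) / n) ≤
      (1 + Real.log N) * (1 + Real.log (1 / η)) * (n : ℝ) ^ (-γ) := by
  have hlogN : 0 ≤ Real.log N := Real.log_nonneg hN
  have hlogη : 0 ≤ Real.log (1 / η) := Real.log_nonneg ((one_le_div hη0).2 hη1)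
  have hrate : (√(n : ℝ))⁻¹ ≤ (n : ℝ) ^ (-γ) := by
    rw [Real.sqrt_eq_rpow, ← Real.rpow_neg (Nat.cast_nonneg n)]
    exact Real.rpow_le_rpow_of_exponent_le (by exact_mod_cast hn) (neg_le_neg hγ)
  have hsqrt : √(2 * (Real.log N + Real.log (1 / η))) ≤
      (1 + Real.log N) * (1 + Real.log (1 / η)) := by
    calc √(2 * (Real.log N + Real.log (1 / η))) ≤ 1 + (Real.log N + Real.log (1 / η)) :=
          Real.sqrt_le_iff.2 ⟨by positivity,
            by linarith [sq_nonneg (Real.log N + Real.log (1 / η))]⟩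
      _ ≤ (1 + Real.log N) * (1 + Real.log (1 / η)) := by
          linarith [mul_nonneg hlogN hlogη]
  rw [div_eq_mul_one_div N, Real.log_mul (by positivity) (by positivity),
    Real.sqrt_div' _ (Nat.cast_nonneg n), div_eq_mul_inv]
  exact mul_le_mul hsqrt hrate (by positivity) (by positivity)

theorem deviation_le_rate {R C γ η N : ℝ} (hb : 0 ≤ b) (hC : 0 ≤ C)
    (hR : R ≤ C * (n : ℝ) ^ (-γ)) (hN : 1 ≤ N) (hη0 : 0 < η) (hη1 : η ≤ 1) (hγ : γ ≤ 1 / 2)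
    (hn : 1 ≤ n) :
    4 * b * R + b * √(2 * Real.log (N / η) / n) ≤
      b * (4 * C + 1 + Real.log N) * (1 + Real.log (1 / η)) * (n : ℝ) ^ (-γ) := by
  have hlog : 1 ≤ 1 + Real.log (1 / η) :=
    le_add_of_nonneg_right (Real.log_nonneg ((one_le_div hη0).2 hη1))
  have hRlog : R ≤ C * (1 + Real.log (1 / η)) * (n : ℝ) ^ (-γ) :=
    hR.trans (mul_le_mul_of_nonneg_right (le_mul_of_one_le_right hC hlog) (by positivity))
  calc 4 * b * R + b * √(2 * Real.log (N / η) / n)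
      ≤ 4 * b * (C * (1 + Real.log (1 / η)) * (n : ℝ) ^ (-γ)) +
          b * ((1 + Real.log N) * (1 + Real.log (1 / η)) * (n : ℝ) ^ (-γ)) := by
        gcongr
        exact sqrt_log_div_le hN hη0 hη1 hγ hn
    _ = b * (4 * C + 1 + Real.log N) * (1 + Real.log (1 / η)) * (n : ℝ) ^ (-γ) := by ring

end FairClassification

end FairTradeoff

open FairTradeoff in
theorem theorem3p4 (L : NNReal) (C γ B p : ℝ) (m : ℕ) (hC : 0 ≤ C) (hγ : γ ≤ 1 / 2)
    (hp : 0 < p) :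
    ∃ (K : ℝ) (k : ℕ), ∀ (X : Type*) (A : Type*) [MeasurableSpace X] [MeasurableSpace A]
      (P : MeasureTheory.Measure (X × A × Bool)) [MeasureTheory.IsProbabilityMeasure P]
      (F : FairTradeoff.FairnessMetric X A m) (H : Set (X → Bool)),
      (∀ h ∈ H, Measurable h) →
      (∀ j z b, |F.g j z b| ≤ B) →
      (∀ j, p ≤ P.real (F.event j)) →
      (∀ h ∈ H, FairTradeoff.fair P F h ≤ 1) →
      LipschitzOnWith L (FairTradeoff.tradeoff P F H) (Set.Icc 0 1) →
      ∀ n : ℕ, 1 ≤ n →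
      FairTradeoff.rademacherComplexity (P.map Prod.fst) H n ≤ C * (n : ℝ) ^ (-γ) →
      ∀ (δ η : ℝ), 0 < η → η < 1 →
      ∃ G : Set (Fin n → X × A × Bool), MeasurableSet G ∧
        1 - η ≤ (MeasureTheory.Measure.pi fun _ : Fin n => P).real G ∧
        ∀ D ∈ G, ∀ h, FairTradeoff.IsEmpiricalMinimiser F H δ D h →
          FairTradeoff.gap P F H h ≤ K * (1 + Real.log (1 / η)) ^ k * (n : ℝ) ^ (-γ) := by
  set b := max B 1
  have hb1 : 1 ≤ b := le_max_right _ _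
  have hb0 : 0 ≤ b := zero_le_one.trans hb1
  refine ⟨(2 * L + 2 * m * (1 + b) / p) * (b * (4 * C + 1 + Real.log (4 * m + 2))), 1, ?_⟩
  intro X A _ _ P _ F H hH hB hpe hfair hLip n hn hR δ η hη0 hη1
  have hgb : ∀ j z y, |F.g j z y| ≤ b := fun j z y => (hB j z y).trans (le_max_left _ _)
  have hN : (1 : ℝ) ≤ 4 * m + 2 := by linarith [(Nat.cast_nonneg m : (0 : ℝ) ≤ m)]
  refine (holdsWithProb_gap_le hH hb1 hgb hp hpe hfair hLip hn hη0 hη1.le δ).mono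
    fun D hD h hmin => ?_
  calc gap P F H h ≤ _ := hD h hmin
    _ ≤ (2 * L + 2 * m * (1 + b) / p) *
          (b * (4 * C + 1 + Real.log (4 * m + 2)) * (1 + Real.log (1 / η)) * (n : ℝ) ^ (-γ)) := by
        gcongr
        exact deviation_le_rate hb0 hC hR hN hη0 hη1.le hγ hn
    _ = _ := by ring
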